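/- For a positive integer $n$ let $B_n=\{(i,j): 1\le i,j\le n\}\cup\{0\}$ be the Brandt semigroup with multiplication $(i,j)(k,l)=(i,l)$ if $j=k$, $(i,j)(k,l)=0$ if $j\neq k$, and $0x=x0=0$ for all $x\in B_n$. Let $\Delta(B_n)$ be its commuting graph, that is, the simple graph whose vertices are the non-central elements of $B_n$, two distinct vertices $x,y$ being adjacent if and only if $xy=yx$. A retract of a graph $G$ is a subgraph $H$ of $G$ for which there is a graph homomorphism $G\to H$ that fixes every vertex of $H$, and a graph is a core if it has no retract other than itself. If $n\ge 5$, then every endomorphism of $\Delta(B_n)$ (adjacency-preserving map of the vertex set to itself) is an automorphism, i.e. $\mathrm{End}(\Delta(B_n))=\mathrm{Aut}(\Delta(B_n))$, and $\Delta(B_n)$ is a core, i.e. it has no proper retract. -/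

import Mathlib

/-- The underlying set of the (aperiodic) Brandt semigroup `B_n`: a zero element together with
the pairs `(i, j)`, where `i` and `j` range over an `n`-element set. -/
inductive Brandt (n : ℕ) : Type
  | zero : Brandt n
  | pair (i j : Fin n) : Brandt n

namespace Brandt

/-- The product of `B_n`: `(i, j) (k, l)` is `(i, l)` if `j = k` and `0` otherwise, and every
product with a factor `0` is `0`. -/
def mul {n : ℕ} : Brandt n → Brandt n → Brandt n
  | pair i j, pair k l => if j = k then pair i l else zero
  | _, _ => zero

instance instSemigroup (n : ℕ) : Semigroup (Brandt n) where
  mul := mul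
  mul_assoc a b c := by
    change mul (mul a b) c = mul a (mul b c)
    cases a <;> cases b <;> cases c <;> simp only [mul] <;> split_ifs <;> simp_all

end Brandt

/-- The commuting graph `Δ(S)` of a semigroup `S`: its vertices are the non-central elements
of `S`, and two distinct vertices are adjacent if they commute in `S`. -/
def commutingGraph (S : Type*) [Semigroup S] : SimpleGraph {x : S // x ∉ Set.center S} where
  Adj x y := x ≠ y ∧ (x : S) * (y : S) = (y : S) * (x : S)
  symm := ⟨fun _ _ h => ⟨h.1.symm, h.2.symm⟩⟩
  loopless := ⟨fun _ h => h.1 rfl⟩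

namespace SimpleGraph

variable {V : Type*}

/-- A subgraph `H` of `G` is a retract of `G` if there is a graph homomorphism from `G` to `H`
that fixes every vertex of `H`. -/
def IsRetract (G : SimpleGraph V) (H : G.Subgraph) : Prop :=
  ∃ f : G →g H.coe, ∀ x : H.verts, f (x : V) = x

/-- A graph is a core if it has no proper retract. -/
def IsCore (G : SimpleGraph V) : Prop :=
  ∀ H : G.Subgraph, G.IsRetract H → H = ⊤

end SimpleGraph

/-! Since `0` is the only central element and two distinct pairs commute only when both products
vanish, `Δ(B_n)` is `arcGraph (Fin n)`. For `n ≥ 5` its largest cliques are cuts `A ×ˢ Aᶜ` with `A`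
as near to half as possible (`exists_eq_product_compl_of_isClique`). An endomorphism is injective on
cliques, so an idempotent one maps a largest clique onto some cut, and fixes that cut pointwise
because it lies in the image.

Fixing one cut forces the identity (`FixesCut.map_eq`): every other arc is constrained by the fixed
arcs adjacent to it, and counting arguments exclude the remaining images. So the identity is the
only idempotent endomorphism. A retraction is idempotent, hence the graph is a core; in the finite
endomorphism monoid some positive power of each element is idempotent, hence the identity, so each
element is invertible. -/

/-- The graph of ordered pairs (arcs, loops included) over `α`, in which two distinct arcs are
adjacent if neither of them can be followed by the other. -/
def arcGraph (α : Type*) : SimpleGraph (α × α) where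
  Adj p q := p ≠ q ∧ p.2 ≠ q.1 ∧ q.2 ≠ p.1
  symm := ⟨fun _ _ h => ⟨h.1.symm, h.2.2, h.2.1⟩⟩
  loopless := ⟨fun _ h => h.1 rfl⟩

/-! ### Arcs and their reversal -/

namespace arcGraph

variable {α : Type*}

theorem adj_iff {i j k l : α} :
    (arcGraph α).Adj (i, j) (k, l) ↔ ¬ (i = k ∧ j = l) ∧ j ≠ k ∧ l ≠ i := by
  simp [arcGraph, Prod.ext_iff]

/-- Reversal of arcs conjugates endomorphisms of `arcGraph α` into endomorphisms. -/
def reverse (f : arcGraph α →g arcGraph α) : arcGraph α →g arcGraph α where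
  toFun p := (f p.swap).swap
  map_rel' := by
    rintro ⟨i, j⟩ ⟨k, l⟩ h
    have h' : (arcGraph α).Adj (j, i) (l, k) := by
      rw [adj_iff] at h ⊢; tauto
    have := f.map_adj h'
    simp only [Prod.swap_prod_mk]
    rcases hp : f (j, i) with ⟨p, q⟩
    rcases hq : f (l, k) with ⟨r, s⟩
    rw [hp, hq, adj_iff] at this
    simp only [Prod.swap_prod_mk, adj_iff]
    tauto

theorem reverse_eq_iff {f : arcGraph α →g arcGraph α} {i j k l : α} :
    reverse f (i, j) = (k, l) ↔ f (j, i) = (l, k) := by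
  change (f (j, i)).swap = (k, l) ↔ _
  rw [Prod.swap_eq_iff_eq_swap]
  rfl

variable {f : arcGraph α →g arcGraph α}

theorem map_adj_eq {i j k l p q r s : α} (h₁ : f (i, j) = (p, q)) (h₂ : f (k, l) = (r, s))
    (h : ¬ (i = k ∧ j = l) ∧ j ≠ k ∧ l ≠ i) : ¬ (p = r ∧ q = s) ∧ q ≠ r ∧ s ≠ p := by
  have := f.map_adj (adj_iff.2 h)
  rwa [h₁, h₂, adj_iff] at this

theorem exists_mem_ne {A : Finset α} (hA : 2 ≤ A.card) (a : α) : ∃ x ∈ A, x ≠ a :=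
  Finset.exists_mem_ne (by omega) a

/-! ### Endomorphisms fixing a cut -/

variable [Fintype α] [DecidableEq α] {A : Finset α}

/-- `f` fixes every arc from `A` to its complement. -/
def FixesCut (f : arcGraph α →g arcGraph α) (A : Finset α) : Prop :=
  ∀ a ∈ A, ∀ b ∉ A, f (a, b) = (a, b)

/-- This duality exchanges `A` with its complement and heads with tails, so each result about one
side of the cut yields the other. -/
theorem FixesCut.reverse (hf : FixesCut f A) : FixesCut (reverse f) Aᶜ := by
  intro b hb a ha
  rw [Finset.mem_compl] at hb
  rw [Finset.mem_compl, not_not] at ha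
  exact reverse_eq_iff.2 (hf a ha b hb)

theorem exists_notMem_ne (hA : 2 ≤ Aᶜ.card) (b : α) : ∃ x ∉ A, x ≠ b := by
  obtain ⟨x, hx, h⟩ := exists_mem_ne hA b
  exact ⟨x, Finset.mem_compl.1 hx, h⟩

/-- Possible images of an arc inside `A`. -/
theorem FixesCut.map_inside (hf : FixesCut f A) (hA : 2 ≤ A.card) (hB : 2 ≤ Aᶜ.card)
    {a a' p q : α} (ha : a ∈ A) (ha' : a' ∈ A) (h : f (a, a') = (p, q)) :
    (p ∈ A ∧ q = a') ∨ (p = a' ∧ q ∉ A) := by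
  -- The arc `(a, a')` is adjacent to every cut arc with tail other than `a'`; these are fixed, so
  -- its image is adjacent to them too.
  have key : ∀ x ∈ A, x ≠ a' → ∀ y ∉ A, ¬ (p = x ∧ q = y) ∧ q ≠ x ∧ y ≠ p := by
    intro x hx hxa y hy
    refine map_adj_eq h (hf x hx y hy) ⟨?_, hxa.symm, ?_⟩
    · rintro ⟨rfl, rfl⟩; exact hy ha'
    · rintro rfl; exact hy ha
  obtain ⟨x, hx, hxa⟩ := exists_mem_ne hA a'
  obtain ⟨y, hy, -⟩ := exists_notMem_ne hB a'
  have hp : p ∈ A := by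
    by_contra hp
    exact (key x hx hxa p hp).2.2 rfl
  by_cases hq : q ∈ A
  · left
    refine ⟨hp, ?_⟩
    by_contra hqa
    exact (key q hq hqa y hy).2.1 rfl
  · right
    refine ⟨?_, hq⟩
    by_contra hpa
    exact (key p hp hpa q hq).1 ⟨rfl, rfl⟩

/-- Possible images of an arc outside `A`. -/
theorem FixesCut.map_outside (hf : FixesCut f A) (hA : 2 ≤ A.card) (hB : 2 ≤ Aᶜ.card)
    {b b' p q : α} (hb : b ∉ A) (hb' : b' ∉ A) (h : f (b, b') = (p, q)) :
    (q ∉ A ∧ p = b) ∨ (q = b ∧ p ∈ A) := by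
  simpa using hf.reverse.map_inside hB (by simpa using hA) (Finset.mem_compl.2 hb')
    (Finset.mem_compl.2 hb) (reverse_eq_iff.2 h)

/-- The arcs `(a₁, a)` and `(b, b')` are adjacent, so the image of the latter can neither follow nor
equal `(a, b)`; this leaves only the second case of `map_outside`. -/
theorem FixesCut.map_outside_of_map_inside (hf : FixesCut f A) (hA : 2 ≤ A.card)
    (hB : 2 ≤ Aᶜ.card) {a₁ a b b' : α} (ha₁ : a₁ ∈ A) (ha : a ∈ A) (hb : b ∉ A)
    (h : f (a₁, a) = (a, b)) (hb' : b' ∉ A) : ∃ c ∈ A, c ≠ a ∧ f (b, b') = (c, b) := by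
  rcases hr : f (b, b') with ⟨p, q⟩
  have hadj := map_adj_eq h hr
    ⟨fun e => hb (e.1 ▸ ha₁), fun e => hb (e ▸ ha), fun e => hb' (e ▸ ha₁)⟩
  rcases hf.map_outside hA hB hb hb' hr with ⟨-, rfl⟩ | ⟨rfl, hp⟩
  · exact absurd rfl hadj.2.1
  · exact ⟨p, hp, fun e => hadj.1 ⟨e.symm, rfl⟩, rfl⟩

/-- If some arc inside `A` with head `a` goes to `(a, b)`, then the arcs outside `A` with tail `b`
go injectively to arcs from `A \ {a}` to `b`. -/
theorem FixesCut.exists_injOn_outside (hf : FixesCut f A) (hA : 2 ≤ A.card)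
    (hB : 2 ≤ Aᶜ.card) {a₁ a b : α} (ha₁ : a₁ ∈ A) (ha : a ∈ A) (hb : b ∉ A)
    (h : f (a₁, a) = (a, b)) :
    ∃ g : α → α, Set.InjOn g (Aᶜ.erase b) ∧ Set.MapsTo g (Aᶜ.erase b) (A.erase a) ∧
      ∀ b' ∉ A, f (b, b') = (g b', b) := by
  refine ⟨fun b' => (f (b, b')).1, ?_, ?_, ?_⟩
  · intro x hx y hy hxy
    simp only [Finset.coe_erase, Finset.coe_compl, Set.mem_sdiff, Set.mem_compl_iff,
      Finset.mem_coe, Set.mem_singleton_iff] at hx hy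
    obtain ⟨c, -, -, hc⟩ := hf.map_outside_of_map_inside hA hB ha₁ ha hb h hx.1
    obtain ⟨d, -, -, hd⟩ := hf.map_outside_of_map_inside hA hB ha₁ ha hb h hy.1
    by_contra hne
    have := map_adj_eq hc hd ⟨fun e => hne e.2, hx.2, hy.2⟩
    simp only [hc, hd] at hxy
    exact this.1 ⟨hxy, rfl⟩
  · intro x hx
    simp only [Finset.coe_erase, Finset.coe_compl, Set.mem_sdiff, Set.mem_compl_iff,
      Finset.mem_coe, Set.mem_singleton_iff] at hx ⊢
    obtain ⟨c, hcA, hca, hc⟩ := hf.map_outside_of_map_inside hA hB ha₁ ha hb h hx.1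
    simpa [hc] using ⟨hcA, hca⟩
  · intro x hx
    obtain ⟨c, -, -, hc⟩ := hf.map_outside_of_map_inside hA hB ha₁ ha hb h hx
    simp only [hc]

theorem FixesCut.exists_injOn_inside (hf : FixesCut f A) (hA : 2 ≤ A.card)
    (hB : 2 ≤ Aᶜ.card) {b b₁ a : α} (hb : b ∉ A) (hb₁ : b₁ ∉ A) (ha : a ∈ A)
    (h : f (b, b₁) = (a, b)) :
    ∃ g : α → α, Set.InjOn g (A.erase a) ∧ Set.MapsTo g (A.erase a) (Aᶜ.erase b) ∧
      ∀ a' ∈ A, f (a', a) = (a, g a') := by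
  simpa [reverse_eq_iff] using hf.reverse.exists_injOn_outside hB (by simpa using hA)
    (Finset.mem_compl.2 hb₁) (Finset.mem_compl.2 hb) (by simpa using ha)
    (reverse_eq_iff.2 h)

theorem FixesCut.card_compl_le (hf : FixesCut f A) (hA : 2 ≤ A.card) (hB : 2 ≤ Aᶜ.card)
    {a₁ a b : α} (ha₁ : a₁ ∈ A) (ha : a ∈ A) (hb : b ∉ A) (h : f (a₁, a) = (a, b)) :
    Aᶜ.card ≤ A.card := by
  obtain ⟨g, hg, hm, -⟩ := hf.exists_injOn_outside hA hB ha₁ ha hb h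
  have := Finset.card_le_card_of_injOn g hm hg
  rw [Finset.card_erase_of_mem ha, Finset.card_erase_of_mem (Finset.mem_compl.2 hb)] at this
  omega

/-- The bad arc `(a₁, a)` produces a bad arc `(b, b')` on the other side, so the inequality also
holds for the reversed map. -/
theorem FixesCut.card_compl_eq (hf : FixesCut f A) (hA : 2 ≤ A.card) (hB : 2 ≤ Aᶜ.card)
    {a₁ a b : α} (ha₁ : a₁ ∈ A) (ha : a ∈ A) (hb : b ∉ A) (h : f (a₁, a) = (a, b)) :
    Aᶜ.card = A.card := by
  refine le_antisymm (hf.card_compl_le hA hB ha₁ ha hb h) ?_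
  obtain ⟨b', hb', -⟩ := exists_notMem_ne hB b
  obtain ⟨c, hc, -, hcb⟩ := hf.map_outside_of_map_inside hA hB ha₁ ha hb h hb'
  simpa using hf.reverse.card_compl_le hB (by simpa using hA) (Finset.mem_compl.2 hb')
    (Finset.mem_compl.2 hb) (by simpa using hc) (reverse_eq_iff.2 hcb)

/-- If some arc inside `A` with head `a` goes to `(a, b)`, then for every `x ∈ A \ {a}` the arcs
from `A \ {x}` to `x` go bijectively to the arcs from `x` to `Aᶜ \ {b}`. -/
theorem FixesCut.exists_bijOn (hf : FixesCut f A) (hA : 2 ≤ A.card) (hB : 2 ≤ Aᶜ.card)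
    {a₁ a b x : α} (ha₁ : a₁ ∈ A) (ha : a ∈ A) (hb : b ∉ A) (h : f (a₁, a) = (a, b))
    (hx : x ∈ A) (hxa : x ≠ a) :
    ∃ g : α → α, Set.BijOn g (A.erase x) (Aᶜ.erase b) ∧ ∀ a' ∈ A, f (a', x) = (x, g a') := by
  have hcard := hf.card_compl_eq hA hB ha₁ ha hb h
  have hcard' : ∀ y ∈ A, (Aᶜ.erase b).card = (A.erase y).card := by
    intro y hy
    rw [Finset.card_erase_of_mem hy, Finset.card_erase_of_mem (Finset.mem_compl.2 hb), hcard]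
  obtain ⟨g, hg, hm, hgf⟩ := hf.exists_injOn_outside hA hB ha₁ ha hb h
  -- Equal cardinalities make `g` surjective, so some `(b, b')` goes to `(x, b)`; the dual statement
  -- then applies at `x`.
  obtain ⟨b', hb', rfl⟩ := Finset.surjOn_of_injOn_of_card_le g hm hg (hcard' a ha).ge
    (show x ∈ (A.erase a : Finset α) from Finset.mem_erase.2 ⟨hxa, hx⟩)
  have hb'A : b' ∉ A := Finset.mem_compl.1 (Finset.mem_of_mem_erase hb')
  obtain ⟨k, hk, hkm, hkf⟩ := hf.exists_injOn_inside hA hB hb hb'A hx (hgf b' hb'A)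
  exact ⟨k, ⟨hkm, hk, Finset.surjOn_of_injOn_of_card_le k hkm hk (hcard' _ hx).le⟩, hkf⟩

/-- The head of an arc inside `A` is preserved. -/
theorem FixesCut.map_inside_snd (hf : FixesCut f A) (hn : 5 ≤ Fintype.card α)
    (hA : 2 ≤ A.card) (hB : 2 ≤ Aᶜ.card) {a₁ a : α} (ha₁ : a₁ ∈ A) (ha : a ∈ A)
    (hne : a₁ ≠ a) : ∃ p ∈ A, f (a₁, a) = (p, a) := by
  rcases h : f (a₁, a) with ⟨p, q⟩
  rcases hf.map_inside hA hB ha₁ ha h with ⟨hp, rfl⟩ | ⟨rfl, hq⟩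
  · exact ⟨p, hp, rfl⟩
  exfalso
  have hcard := hf.card_compl_eq hA hB ha₁ ha hq h
  have hsum := A.card_add_card_compl
  -- Both sides have equal size and `n ≥ 5`, so `A` has a third element.
  obtain ⟨a₂, ha₂, ha₂'⟩ := Finset.exists_mem_notMem_of_card_lt_card
    (s := {a₁, p}) (t := A) (lt_of_le_of_lt Finset.card_le_two (by omega))
  simp only [Finset.mem_insert, Finset.mem_singleton, not_or] at ha₂'
  rcases h₂ : f (a₂, p) with ⟨r, s⟩
  have hadj := map_adj_eq h h₂ ⟨fun e => ha₂'.1 e.1.symm, fun e => ha₂'.2 e.symm, hne.symm⟩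
  rcases hf.map_inside hA hB ha₂ ha h₂ with ⟨-, rfl⟩ | ⟨rfl, hs⟩
  · exact hadj.2.2 rfl
  -- The same arcs into `a₁` would go onto the arcs from `a₁` to `Aᶜ \ {q}` and onto those to `Aᶜ \
  -- {s}`, although `s ≠ q`.
  obtain ⟨g, hg, hgf⟩ := hf.exists_bijOn hA hB ha₁ ha hq h ha₁ hne
  obtain ⟨k, hk, hkf⟩ := hf.exists_bijOn hA hB ha₂ ha hs h₂ ha₁ hne
  have hsq : s ≠ q := fun e => hadj.1 ⟨rfl, e.symm⟩
  obtain ⟨x, hx, hxs⟩ := hg.surjOn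
    (show s ∈ (Aᶜ.erase q : Finset α) from Finset.mem_erase.2 ⟨hsq, Finset.mem_compl.2 hs⟩)
  have hxA : x ∈ A := Finset.mem_of_mem_erase hx
  have hkx := hk.mapsTo hx
  have : g x = k x := (Prod.ext_iff.1 ((hgf x hxA).symm.trans (hkf x hxA))).2
  rw [← this, hxs] at hkx
  exact Finset.notMem_erase s _ hkx

theorem FixesCut.map_back_aux (hf : FixesCut f A) (hn : 5 ≤ Fintype.card α)
    (hA : 2 ≤ A.card) (hB : 2 ≤ Aᶜ.card) {a b p q : α} (ha : a ∈ A) (hb : b ∉ A)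
    (h : f (b, a) = (p, q)) : p ≠ a ∧ ¬ (q = a ∧ p ∈ A) := by
  have hpa : p ≠ a := by
    obtain ⟨x, hx, hxa⟩ := exists_mem_ne hA a
    obtain ⟨r, -, hr⟩ := hf.map_inside_snd hn hA hB hx ha hxa
    exact (map_adj_eq h hr
      ⟨fun e => hb (e.1 ▸ hx), hxa.symm, fun e => hb (e ▸ ha)⟩).2.2.symm
  refine ⟨hpa, ?_⟩
  rintro ⟨rfl, hp⟩
  -- Pigeonhole: the arcs into `q` from `A \ {q}` are pairwise adjacent and adjacent to `(b, q)`, so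
  -- their tails would inject into `A \ {q, p}`.
  have key : ∀ x ∈ A.erase q, ∃ r ∈ (A.erase q).erase p, f (x, q) = (r, q) := by
    intro x hx
    have hx' := Finset.mem_erase.1 hx
    obtain ⟨r, hrA, hr⟩ := hf.map_inside_snd hn hA hB hx'.2 ha hx'.1
    have := map_adj_eq h hr ⟨fun e => hb (e.1 ▸ hx'.2), hx'.1.symm, fun e => hb (e ▸ ha)⟩
    exact ⟨r, Finset.mem_erase.2 ⟨fun e => this.1 ⟨e.symm, rfl⟩,
      Finset.mem_erase.2 ⟨this.2.1.symm, hrA⟩⟩, hr⟩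
  have hle := Finset.card_le_card_of_injOn (s := A.erase q) (t := (A.erase q).erase p)
    (fun x => (f (x, q)).1)
    (fun x hx => by
      obtain ⟨r, hr, e⟩ := key x hx
      simpa only [e, Finset.mem_coe] using hr)
    (fun x hx y hy hxy => by
      obtain ⟨r, -, e⟩ := key x hx
      obtain ⟨s, -, e'⟩ := key y hy
      simp only [e, e'] at hxy
      by_contra hne
      exact (map_adj_eq e e' ⟨fun t => hne t.1, (Finset.ne_of_mem_erase hy).symm,
        (Finset.ne_of_mem_erase hx).symm⟩).1 ⟨hxy, rfl⟩)
  exact absurd hle (not_le.2 (Finset.card_erase_lt_of_mem (Finset.mem_erase.2 ⟨hpa, hp⟩)))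

/-- Arcs from the complement of `A` to `A` are fixed as well. -/
theorem FixesCut.map_back (hf : FixesCut f A) (hn : 5 ≤ Fintype.card α)
    (hA : 2 ≤ A.card) (hB : 2 ≤ Aᶜ.card) {a b : α} (ha : a ∈ A) (hb : b ∉ A) :
    f (b, a) = (b, a) := by
  rcases h : f (b, a) with ⟨p, q⟩
  have key : ∀ x ∈ A, x ≠ a → ∀ y ∉ A, y ≠ b → ¬ (p = x ∧ q = y) ∧ q ≠ x ∧ y ≠ p :=
    fun x hx hxa y hy hyb => map_adj_eq h (hf x hx y hy)
      ⟨fun e => hb (e.1 ▸ hx), hxa.symm, hyb⟩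
  obtain ⟨h₁, h₂⟩ := hf.map_back_aux hn hA hB ha hb h
  obtain ⟨h₃, h₄⟩ : q ≠ b ∧ ¬ (p = b ∧ q ∈ Aᶜ) :=
    hf.reverse.map_back_aux hn hB (by simpa using hA) (Finset.mem_compl.2 hb)
      (by simpa using ha) (reverse_eq_iff.2 h)
  obtain ⟨x, hx, hxa⟩ := exists_mem_ne hA a
  obtain ⟨y, hy, hyb⟩ := exists_notMem_ne hB b
  have hp : p ∈ A ∨ p = b := by
    by_contra! hp
    exact (key x hx hxa p hp.1 hp.2).2.2 rfl
  have hq : q ∉ A ∨ q = a := by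
    by_contra! hq
    exact (key q hq.1 hq.2 y hy hyb).2.1 rfl
  rw [Finset.mem_compl] at h₄
  -- Otherwise `(p, q)` would be a fixed cut arc adjacent to `(b, a)`, hence adjacent to its own
  -- image.
  have : ¬ (p ∈ A ∧ q ∉ A) := fun e => (key p e.1 h₁ q e.2 h₃).1 ⟨rfl, rfl⟩
  have : p = b ∧ q = a := by tauto
  rw [this.1, this.2]

/-- The backward arcs, now also fixed, pin down the tail of the image. -/
theorem FixesCut.map_inside_eq (hf : FixesCut f A) (hn : 5 ≤ Fintype.card α)
    (hA : 2 ≤ A.card) (hB : 2 ≤ Aᶜ.card) {a a' : α} (ha : a ∈ A) (ha' : a' ∈ A) :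
    f (a, a') = (a, a') := by
  rcases h : f (a, a') with ⟨p, q⟩
  have key : ∀ x ∈ A, x ≠ a → ∀ y ∉ A, ¬ (p = y ∧ q = x) ∧ q ≠ y ∧ x ≠ p :=
    fun x hx hxa y hy => map_adj_eq h (hf.map_back hn hA hB hx hy)
      ⟨fun e => hy (e.1 ▸ ha), fun e => hy (e ▸ ha'), hxa⟩
  obtain ⟨x, hx, hxa⟩ := exists_mem_ne hA a
  obtain ⟨y, hy, -⟩ := exists_notMem_ne hB a
  rcases hf.map_inside hA hB ha ha' h with ⟨hp, rfl⟩ | ⟨-, hq⟩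
  · by_cases hpa : p = a
    · rw [hpa]
    · exact absurd rfl (key p hp hpa y hy).2.2
  · exact absurd rfl (key x hx hxa q hq).2.1

/-- An endomorphism that fixes every arc from `A` to its complement is the identity. -/
theorem FixesCut.map_eq (hf : FixesCut f A) (hn : 5 ≤ Fintype.card α)
    (hA : 2 ≤ A.card) (hB : 2 ≤ Aᶜ.card) (v : α × α) : f v = v := by
  obtain ⟨i, j⟩ := v
  by_cases hi : i ∈ A <;> by_cases hj : j ∈ A
  · exact hf.map_inside_eq hn hA hB hi hj
  · exact hf i hi j hj
  · exact hf.map_back hn hA hB hj hi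
  · exact reverse_eq_iff.1 (hf.reverse.map_inside_eq hn hB (by simpa using hA)
      (Finset.mem_compl.2 hj) (Finset.mem_compl.2 hi))

/-! ### Largest cliques -/

/-- A clique of size at least `⌊n² / 4⌋` consists of the arcs from a set to its complement. -/
theorem exists_eq_product_compl_of_isClique (hn : 5 ≤ Fintype.card α) {C : Finset (α × α)}
    (hC : (arcGraph α).IsClique C) (hcard : Fintype.card α ^ 2 ≤ 4 * C.card + 1) :
    ∃ A : Finset α, 2 ≤ A.card ∧ 2 ≤ Aᶜ.card ∧ C = A ×ˢ Aᶜ := by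
  set L : Finset α := Finset.univ.filter fun i => (i, i) ∈ C with hL
  set S : Finset α := Finset.univ.filter fun i => ∃ j, j ≠ i ∧ (i, j) ∈ C with hS
  set T : Finset α := Finset.univ.filter fun j => ∃ i, i ≠ j ∧ (i, j) ∈ C with hT
  have hadj : ∀ {i j k l : α}, (i, j) ∈ C → (k, l) ∈ C → ¬ (i = k ∧ j = l) → j ≠ k ∧ l ≠ i := by
    intro i j k l h h' hne
    exact (adj_iff.1 (hC h h' (by simpa [Prod.ext_iff] using hne))).2
  have hST : Disjoint S T := by
    rw [Finset.disjoint_left]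
    intro i hi hi'
    obtain ⟨j, hj, hij⟩ := (Finset.mem_filter.1 hi).2
    obtain ⟨k, hk, hki⟩ := (Finset.mem_filter.1 hi').2
    exact (hadj hki hij fun e => hk e.1).1 rfl
  have hSL : Disjoint (S ∪ T) L := by
    rw [Finset.disjoint_left]
    intro i hi hi'
    have hii := (Finset.mem_filter.1 hi').2
    rcases Finset.mem_union.1 hi with hi | hi
    · obtain ⟨j, hj, hij⟩ := (Finset.mem_filter.1 hi).2
      exact (hadj hii hij fun e => hj e.2.symm).1 rfl
    · obtain ⟨j, hj, hji⟩ := (Finset.mem_filter.1 hi).2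
      exact (hadj hji hii fun e => hj e.1).1 rfl
  have hsub : C ⊆ L.image (fun i => (i, i)) ∪ S ×ˢ T := by
    rintro ⟨i, j⟩ hij
    by_cases e : i = j
    · subst e
      exact Finset.mem_union_left _ (Finset.mem_image.2 ⟨i, by simpa [hL] using hij, rfl⟩)
    · refine Finset.mem_union_right _ (Finset.mem_product.2 ⟨?_, ?_⟩)
      · exact Finset.mem_filter.2 ⟨Finset.mem_univ _, j, fun h => e h.symm, hij⟩
      · exact Finset.mem_filter.2 ⟨Finset.mem_univ _, i, e, hij⟩
  have hle : C.card ≤ L.card + S.card * T.card := by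
    refine (Finset.card_le_card hsub).trans ((Finset.card_union_le _ _).trans ?_)
    rw [Finset.card_product]
    exact Nat.add_le_add_right Finset.card_image_le _
  have hsum : S.card + T.card + L.card ≤ Fintype.card α := by
    rw [← Finset.card_union_of_disjoint hST, ← Finset.card_union_of_disjoint hSL]
    exact Finset.card_le_univ _
  have hL0 : L.card = 0 := by
    by_contra hl
    have hl : 1 ≤ L.card := Nat.one_le_iff_ne_zero.2 hl
    generalize L.card = l at *
    generalize S.card = s at *
    generalize T.card = t at *
    generalize C.card = c at *
    generalize Fintype.card α = n at *
    obtain ⟨m, rfl⟩ := Nat.exists_eq_add_of_le hsum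
    zify at *
    have h4 : (4 * (s * t) : ℤ) ≤ (s + t + m) ^ 2 := by nlinarith [sq_nonneg ((s : ℤ) - t)]
    generalize hk : (s + t + m : ℤ) = k at *
    have hk' : (s + t + l + m : ℤ) = k + l := by linarith
    have hk0 : 0 ≤ k := by omega
    rw [hk'] at hcard hn
    -- From `(k + l)² ≤ 4 * l + k² + 1`. This needs `n ≥ 5`: for `n = 4` the four loops form a
    -- clique of size `n² / 4`.
    have : (2 * k + l - 4) * l ≤ 1 := by nlinarith
    have h2 : 1 ≤ 2 * k + l - 4 := by omega
    rcases eq_or_lt_of_le hl with h1 | h1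
    · rw [← h1] at this hn; omega
    · nlinarith
  have hST' : S.card + T.card = Fintype.card α := by
    by_contra hne
    have hlt : S.card + T.card + 1 ≤ Fintype.card α := by omega
    rw [hL0] at hle
    generalize S.card = s at *
    generalize T.card = t at *
    nlinarith [sq_nonneg ((s : ℤ) - t), four_mul_le_sq_add s t]
  have hTS : T = Sᶜ := by
    refine Finset.eq_of_subset_of_card_le ?_ ?_
    · intro x hx
      exact Finset.mem_compl.2 fun h => Finset.disjoint_left.1 hST h hx
    · rw [Finset.card_compl]; omega
  have hL0' : L = ∅ := Finset.card_eq_zero.1 hL0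
  rw [hL0', Finset.image_empty, Finset.empty_union] at hsub
  rw [hL0, zero_add] at hle
  have hlarge : ∀ s t : ℕ, s + t = Fintype.card α → C.card ≤ s * t → 2 ≤ s := by
    intro s t hst hc
    by_contra! hs
    have : s * t ≤ 1 * t := Nat.mul_le_mul_right _ (by omega)
    nlinarith
  have hS2 := hlarge _ _ hST' hle
  have hT2 := hlarge _ _ ((add_comm _ _).trans hST') (hle.trans_eq (mul_comm _ _))
  refine ⟨S, hS2, hTS ▸ hT2, ?_⟩
  rw [← hTS]
  refine Finset.eq_of_subset_of_card_le hsub ?_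
  rw [Finset.card_product]
  have := four_mul_le_sq_add S.card T.card
  rw [hST'] at this
  nlinarith

theorem isClique_product_compl (A : Finset α) :
    (arcGraph α).IsClique (A ×ˢ Aᶜ : Finset (α × α)) := by
  rintro ⟨i, j⟩ h ⟨k, l⟩ h' hne
  simp only [Finset.coe_product, Finset.coe_compl, Set.mem_prod, Finset.mem_coe,
    Set.mem_compl_iff] at h h'
  exact adj_iff.2 ⟨fun e => hne (Prod.ext e.1 e.2), fun e => h.2 (e ▸ h'.1),
    fun e => h'.2 (e ▸ h.1)⟩

/-- Take `A` of size `⌊n / 2⌋`; the `+ 1` absorbs the remainder for odd `n`. -/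
theorem exists_sq_card_le :
    ∃ A : Finset α, Fintype.card α ^ 2 ≤ 4 * (A ×ˢ Aᶜ).card + 1 := by
  obtain ⟨A, -, hA⟩ := Finset.exists_subset_card_eq
    (s := (Finset.univ : Finset α)) (n := Fintype.card α / 2) (by
      rw [Finset.card_univ]; exact Nat.div_le_self _ _)
  refine ⟨A, ?_⟩
  rw [Finset.card_product, Finset.card_compl, hA]
  generalize Fintype.card α = n
  rcases Nat.even_or_odd' n with ⟨m, rfl | rfl⟩
  · rw [show 2 * m / 2 = m by omega, show 2 * m - m = m by omega]
    nlinarith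
  · rw [show (2 * m + 1) / 2 = m by omega, show 2 * m + 1 - m = m + 1 by omega]
    nlinarith

/-- The graph `arcGraph α` has no idempotent endomorphism but the identity. -/
theorem map_eq_of_idempotent (hn : 5 ≤ Fintype.card α) (f : arcGraph α →g arcGraph α)
    (hf : ∀ v, f (f v) = f v) (v : α × α) : f v = v := by
  obtain ⟨A₀, hA₀⟩ := exists_sq_card_le (α := α)
  have hclique := isClique_product_compl A₀
  have hinj : Set.InjOn f (A₀ ×ˢ A₀ᶜ : Finset (α × α)) := by
    intro x hx y hy hxy
    by_contra hne
    exact (f.map_adj (hclique hx hy hne)).ne hxy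
  obtain ⟨A, hA, hB, hC⟩ := exists_eq_product_compl_of_isClique hn
    (C := (A₀ ×ˢ A₀ᶜ).image f)
    (by
      rw [Finset.coe_image]
      rintro _ ⟨x, hx, rfl⟩ _ ⟨y, hy, rfl⟩ hne
      exact f.map_adj (hclique hx hy fun e => hne (e ▸ rfl)))
    (by rwa [Finset.card_image_of_injOn hinj])
  have hcut : FixesCut f A := by
    intro a ha b hb
    have hab : (a, b) ∈ (A₀ ×ˢ A₀ᶜ).image f := by
      rw [hC]
      exact Finset.mem_product.2 ⟨ha, Finset.mem_compl.2 hb⟩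
    obtain ⟨x, -, hx⟩ := Finset.mem_image.1 hab
    rw [← hx, hf]
  exact hcut.map_eq hn hA hB v

end arcGraph

/-! ### From idempotent to arbitrary endomorphisms -/

/-- Some positive power of an element of a finite monoid is idempotent. -/
theorem exists_pow_succ_mul_self_eq {M : Type*} [Monoid M] [Finite M] (x : M) :
    ∃ k : ℕ, x ^ (k + 1) * x ^ (k + 1) = x ^ (k + 1) := by
  obtain ⟨i, p, hp⟩ : ∃ i p : ℕ, x ^ (i + (p + 1)) = x ^ i := by
    obtain ⟨i, j, hne, h⟩ := Finite.exists_ne_map_eq_of_infinite fun n : ℕ => x ^ n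
    rcases lt_or_gt_of_ne hne with hij | hij
    · exact ⟨i, j - i - 1, by rw [show i + (j - i - 1 + 1) = j by omega]; exact h.symm⟩
    · exact ⟨j, i - j - 1, by rw [show j + (i - j - 1 + 1) = i by omega]; exact h⟩
  have key : ∀ m r : ℕ, x ^ (i + m + (p + 1) * r) = x ^ (i + m) := by
    intro m r
    induction r with
    | zero => simp
    | succ r ih =>
      rw [show i + m + (p + 1) * (r + 1) = i + (p + 1) + (m + (p + 1) * r) by ring, pow_add, hp,
        ← pow_add, ← add_assoc, ih]
  -- Here `k + 1 = (p + 1) * (i + 1)`, a multiple of the period `p + 1` that is at least the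
  -- preperiod `i`.
  refine ⟨i + p * (i + 1), ?_⟩
  rw [← pow_add, show i + p * (i + 1) + 1 + (i + p * (i + 1) + 1) =
    i + (p * (i + 1) + 1) + (p + 1) * (i + 1) by ring, key, add_assoc]

namespace SimpleGraph

variable {V W : Type*} {G : SimpleGraph V} {G' : SimpleGraph W}

/-- If the identity is the only idempotent endomorphism of a graph, the graph is a core. -/
theorem isCore_of_idempotent (hG : ∀ f : G →g G, (∀ v, f (f v) = f v) → ∀ v, f v = v) :
    G.IsCore := by
  rintro H ⟨f, hf⟩
  have hid : ∀ v, (f v : V) = v :=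
    hG (H.hom.comp f) fun v => congrArg Subtype.val (hf (f v))
  have hverts : ∀ v, v ∈ H.verts := fun v => hid v ▸ (f v).2
  refine Subgraph.ext (Set.eq_univ_of_forall hverts) ?_
  ext v w
  refine ⟨fun h => h.adj_sub, fun h => ?_⟩
  have := f.map_adj (show G.Adj v w from h)
  rwa [Subgraph.coe_adj, hid, hid] at this

/-- If the identity is the only idempotent endomorphism of a finite graph, every endomorphism is
an automorphism. -/
theorem exists_iso_of_idempotent [Finite V]
    (hG : ∀ f : G →g G, (∀ v, f (f v) = f v) → ∀ v, f v = v) (f : G →g G) :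
    ∃ e : G ≃g G, e.toHom = f := by
  have : Finite (G →g G) := Finite.of_injective (fun f => (f : V → V)) DFunLike.coe_injective
  obtain ⟨k, hk⟩ := exists_pow_succ_mul_self_eq (M := G.Adj →r G.Adj) f
  have hid := hG (f ^ (k + 1) : G.Adj →r G.Adj) fun v => DFunLike.congr_fun hk v
  -- As `f ^ (k + 1)` is the identity, `f ^ k` is a two-sided inverse and itself a homomorphism.
  have hl : ∀ v, (f ^ k : G.Adj →r G.Adj) (f v) = v := fun v => by
    rw [pow_succ] at hid; exact hid v
  have hr : ∀ v, f ((f ^ k : G.Adj →r G.Adj) v) = v := fun v => by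
    rw [pow_succ'] at hid; exact hid v
  refine ⟨⟨⟨f, (f ^ k : G.Adj →r G.Adj), hl, hr⟩, ?_⟩, rfl⟩
  intro a b
  refine ⟨fun h => ?_, fun h => f.map_adj h⟩
  have := (f ^ k : G.Adj →r G.Adj).map_rel h
  simpa only [Equiv.coe_fn_mk, hl] using this

theorem idempotent_of_iso (e : G ≃g G')
    (hG' : ∀ f : G' →g G', (∀ v, f (f v) = f v) → ∀ v, f v = v) (f : G →g G)
    (hf : ∀ v, f (f v) = f v) (v : V) : f v = v := by
  have := hG' (e.toHom.comp (f.comp e.symm.toHom)) (fun w => by simp [hf]) (e v)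
  simpa using this

end SimpleGraph

/-! ### Transfer to the Brandt semigroup -/

namespace Brandt

variable {n : ℕ}

theorem pair_mul_pair (i j k l : Fin n) :
    pair i j * pair k l = if j = k then pair i l else zero := rfl

theorem zero_mem_center : (zero : Brandt n) ∈ Set.center (Brandt n) := by
  rw [Semigroup.mem_center_iff]
  rintro (_ | ⟨i, j⟩) <;> rfl

theorem pair_notMem_center (hn : 2 ≤ n) (i j : Fin n) :
    pair i j ∉ Set.center (Brandt n) := by
  rw [Semigroup.mem_center_iff]
  intro h
  have : Nontrivial (Fin n) := Fin.nontrivial_iff_two_le.2 hn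
  obtain ⟨k, hk⟩ := exists_ne j
  have := h (pair j k)
  rw [pair_mul_pair, pair_mul_pair, if_pos rfl] at this
  split_ifs at this with hki
  simp only [pair.injEq] at this
  exact hk this.2.symm

/-- If both products are nonzero they are `(i, i)` and `(j, j)`, so commuting would force the two
pairs to coincide. -/
theorem pair_mul_comm_iff (i j k l : Fin n) (hne : ¬ (i = k ∧ j = l)) :
    pair i j * pair k l = pair k l * pair i j ↔ j ≠ k ∧ l ≠ i := by
  rw [pair_mul_pair, pair_mul_pair]
  split_ifs with h h'
  · subst h h'
    simp only [pair.injEq]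
    tauto
  · simp [h]
  · simp_all
  · simp_all

/-- The commuting graph of `B_n` is the graph of arcs over an `n`-element set. -/
def commutingGraphIso (hn : 2 ≤ n) : commutingGraph (Brandt n) ≃g arcGraph (Fin n) where
  toFun
    | ⟨pair i j, _⟩ => (i, j)
    | ⟨zero, h⟩ => absurd zero_mem_center h
  invFun p := ⟨pair p.1 p.2, pair_notMem_center hn p.1 p.2⟩
  left_inv := by
    rintro ⟨_ | ⟨i, j⟩, h⟩
    · exact absurd zero_mem_center h
    · rfl
  right_inv _ := rfl
  map_rel_iff' := by
    rintro ⟨_ | ⟨i, j⟩, h⟩ ⟨_ | ⟨k, l⟩, h'⟩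
    · exact absurd zero_mem_center h
    · exact absurd zero_mem_center h
    · exact absurd zero_mem_center h'
    · change (arcGraph (Fin n)).Adj (i, j) (k, l) ↔
        (⟨pair i j, h⟩ : {x // x ∉ Set.center (Brandt n)}) ≠ ⟨pair k l, h'⟩ ∧
          pair i j * pair k l = pair k l * pair i j
      simp only [arcGraph.adj_iff, ne_eq, Subtype.mk.injEq, pair.injEq]
      exact and_congr_right fun hne => (pair_mul_comm_iff i j k l hne).symm

theorem map_eq_of_idempotent (hn : 5 ≤ n)
    (f : commutingGraph (Brandt n) →g commutingGraph (Brandt n)) (hf : ∀ v, f (f v) = f v)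
    (v : {x : Brandt n // x ∉ Set.center (Brandt n)}) : f v = v :=
  SimpleGraph.idempotent_of_iso (commutingGraphIso (by omega))
    (arcGraph.map_eq_of_idempotent (by simpa using hn)) f hf v

end Brandt

/-- For `n ≥ 5`, the endomorphisms of `Δ(B_n)` are exactly its automorphisms, and `Δ(B_n)` is
a core. -/
theorem mainTheorem2 (n : ℕ) (hn : 5 ≤ n) :
    Set.range (fun e : commutingGraph (Brandt n) ≃g commutingGraph (Brandt n) =>
        (e.toHom : commutingGraph (Brandt n) →g commutingGraph (Brandt n))) = Set.univ ∧
      (commutingGraph (Brandt n)).IsCore := by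
  have : Finite {x : Brandt n // x ∉ Set.center (Brandt n)} :=
    Finite.of_equiv _ (Brandt.commutingGraphIso (by omega)).symm.toEquiv
  exact ⟨Set.range_eq_univ.2
      (SimpleGraph.exists_iso_of_idempotent (Brandt.map_eq_of_idempotent hn)),
    SimpleGraph.isCore_of_idempotent (Brandt.map_eq_of_idempotent hn)⟩
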